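/- \textbf{Definitions.} For integers $a,b$ let the signed interval be $\mathrm{si}(a,b)=[a,b]$ if $a\le b$, $\mathrm{si}(a,b)=\emptyset$ if $b=a-1$, and $\mathrm{si}(a,b)=[b+1,a-1]$ if $b<a-1$ (all intervals in $\mathbb{Z}$); in the last case the interval is called negative. An arrowed Gelfand–Tsetlin pattern with $n$ rows is a triangular array $A=(a_{i,j})_{1\le j\le i\le n}$ of integers, each decorated with an element $\operatorname{decor}(a_{i,j})$ of $\{\nwarrow,\nearrow,\nwarrow\!\nearrow,\emptyset\}$, such that for all $1\le j\le i\le n-1$ $$a_{i,j}\in \mathrm{si}\left(a_{i+1,j}+\delta_{i,j},\; a_{i+1,j+1}-\epsilon_{i,j}\right),$$ where $\delta_{i,j}=1$ if $\operatorname{decor}(a_{i+1,j})\in\{\nearrow,\nwarrow\!\nearrow\}$ and $\delta_{i,j}=0$ otherwise, and $\epsilon_{i,j}=1$ if $\operatorname{decor}(a_{i+1,j+1})\in\{\nwarrow,\nwarrow\!\nearrow\}$ and $\epsilon_{i,j}=0$ otherwise. Its bottom row is $(a_{n,1},\dots,a_{n,n})$. Its sign $\operatorname{sgn}(A)$ is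 $-1$ to the number of pairs $(i,j)$, $1\le j\le i\le n-1$, for which the signed interval displayed above is negative. Its weight is $$W(A)=\operatorname{sgn}(A)\,t^{\#\emptyset}u^{\#\nearrow}v^{\#\nwarrow}w^{\#\nwarrow\!\nearrow}\prod_{i=1}^n X_i^{\sum_{j=1}^{i}a_{i,j}-\sum_{j=1}^{i-1}a_{i-1,j}+(\#\nearrow\text{ in row }i)-(\#\nwarrow\text{ in row }i)},$$ where $\#d$ is the number of entries with decoration exactly $d$. Finally, $$\mathbf{ASym}_{X_1,\dots,X_n} f(X_1,\dots,X_n)=\sum_{\sigma\in\mathcal{S}_n}\operatorname{sgn}\sigma\cdot f(X_{\sigma(1)},\dots,X_{\sigma(n)}).$$ \textbf{Corollary.} Let $K$ be a field, let $t,u,v,w\in K$, and let $X_1,\dots,X_n\in K$ be non-zero and pairwise distinct (for example, $K=\mathbb{Q}(t,u,v,w,X_1,\dots,X_n)$ with $t,u,v,w,X_1,\dots,X_n$ indeterminates). Then for all integers $k_1,\dots,k_n$ there are only finitely many arrowed Gelfand–Tsetlin patterns $A$ with bottom row $k_1,\dots,k_n$, and their generating function $\sum_A W(A)$ is $$\sum_A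 W(A)=\frac{\mathbf{ASym}_{X_1,\dots,X_n}\left[\prod_{1\le i\le j\le n}\left(v+wX_i+tX_j+uX_iX_j\right)\prod_{i=1}^n X_i^{k_i-1}\right]}{\prod_{1\le i<j\le n}(X_j-X_i)}.$$ -/

import Mathlib

/-- The four possible decorations of an entry: no arrow, a north-west arrow, a north-east arrow,
or both arrows. -/
inductive ArrowDecoration where
  | empty
  | nw
  | ne
  | nwne
  deriving DecidableEq

namespace ArrowDecoration

/-- The decoration contains an arrow pointing to the north-east. -/
def pointsNE (d : ArrowDecoration) : Prop := d = ne ∨ d = nwne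

/-- The decoration contains an arrow pointing to the north-west. -/
def pointsNW (d : ArrowDecoration) : Prop := d = nw ∨ d = nwne

instance (d : ArrowDecoration) : Decidable d.pointsNE :=
  inferInstanceAs (Decidable (d = ne ∨ d = nwne))

instance (d : ArrowDecoration) : Decidable d.pointsNW :=
  inferInstanceAs (Decidable (d = nw ∨ d = nwne))

end ArrowDecoration

/-- The signed interval of two integers: `[a, b]` if `a ≤ b`, empty if `b = a - 1`, and
`[b + 1, a - 1]` if `b < a - 1`. -/
noncomputable def signedInterval (a b : ℤ) : Finset ℤ :=
  if a ≤ b then Finset.Icc a b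
  else if b = a - 1 then ∅
  else Finset.Icc (b + 1) (a - 1)

/-- The left end of the signed interval attached to an entry `b` with decoration `d`, as left
lower neighbour: `b + 1` if `d` contains a north-east arrow, and `b` otherwise. -/
def leftEnd (b : ℤ) (d : ArrowDecoration) : ℤ := if d.pointsNE then b + 1 else b

/-- The right end of the signed interval attached to an entry `c` with decoration `d`, as right
lower neighbour: `c - 1` if `d` contains a north-west arrow, and `c` otherwise. -/
def rightEnd (c : ℤ) (d : ArrowDecoration) : ℤ := if d.pointsNW then c - 1 else c

/-- Arrowed Gelfand-Tsetlin patterns with `n` rows. The rows are indexed by `0, 1, …, n`, where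
row `i` has `i` entries (so that row `0` is empty); row `n` is the bottom row. Entries within a row
are numbered from `0`. The lower left and lower right neighbours of entry `j` of row `i` are the
entries `j` and `j + 1` of row `i + 1`. -/
@[ext]
structure ArrowedGTPattern (n : ℕ) where
  entry : (i : Fin (n + 1)) → Fin (i : ℕ) → ℤ
  decor : (i : Fin (n + 1)) → Fin (i : ℕ) → ArrowDecoration
  entry_mem : ∀ (i : Fin n) (j : Fin (i : ℕ)),
    entry i.castSucc j ∈ signedInterval
      (leftEnd (entry i.succ j.castSucc) (decor i.succ j.castSucc))
      (rightEnd (entry i.succ j.succ) (decor i.succ j.succ))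

namespace ArrowedGTPattern

variable {n : ℕ}

/-- The bottom row of a pattern (without its decorations). -/
def bottomRow (A : ArrowedGTPattern n) : Fin n → ℤ := A.entry (Fin.last n)

/-- The sign: every negative interval contributes a factor `-1`. -/
def sgn (A : ArrowedGTPattern n) : ℤ :=
  ∏ i : Fin n, ∏ j : Fin (i : ℕ),
    if rightEnd (A.entry i.succ j.succ) (A.decor i.succ j.succ) <
        leftEnd (A.entry i.succ j.castSucc) (A.decor i.succ j.castSucc) - 1
    then -1 else 1

/-- The number of entries in row `i` with decoration `d`. -/
def rowCount (A : ArrowedGTPattern n) (d : ArrowDecoration) (i : Fin (n + 1)) : ℕ :=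
  (Finset.univ.filter fun j => A.decor i j = d).card

/-- The number of entries of the pattern with decoration `d`. -/
def count (A : ArrowedGTPattern n) (d : ArrowDecoration) : ℕ := ∑ i, A.rowCount d i

/-- The exponent of the variable belonging to row `i + 1`. -/
def rowExponent (A : ArrowedGTPattern n) (i : Fin n) : ℤ :=
  ∑ j, A.entry i.succ j - ∑ j, A.entry i.castSucc j
    + (A.rowCount .ne i.succ : ℤ) - (A.rowCount .nw i.succ : ℤ)

/-- The weight of a pattern. -/
def weight {K : Type*} [Field K] (t u v w : K) (X : Fin n → K) (A : ArrowedGTPattern n) : K :=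
  (A.sgn : K) * t ^ A.count .empty * u ^ A.count .ne * v ^ A.count .nw * w ^ A.count .nwne
    * ∏ i : Fin n, X i ^ A.rowExponent i

end ArrowedGTPattern

/-- The generating function of arrowed Gelfand-Tsetlin patterns with bottom row `k`. -/
noncomputable def agtpGenFun {K : Type*} [Field K] {n : ℕ} (t u v w : K) (k : Fin n → ℤ)
    (X : Fin n → K) : K :=
  ∑ᶠ A ∈ {A : ArrowedGTPattern n | A.bottomRow = k}, A.weight t u v w X

/-- The antisymmetrizer, the sum over all permutations `σ` of
`sgn σ * f (X (σ 1), …, X (σ n))`. -/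
def antisymmetrizer {K : Type*} [Field K] {n : ℕ} (f : (Fin n → K) → K) (X : Fin n → K) : K :=
  ∑ σ : Equiv.Perm (Fin n), ((Equiv.Perm.sign σ : ℤ) : K) * f (fun i => X (σ i))

/-! Induction on the number of rows, deleting the bottom row. Let `x` be the last variable and `Y`
the others. For fixed bottom decorations, the sum over the row above is a product of signed
geometric sums in `Y j / x`, each a difference of two end terms (`sum_signedInterval_zpow`).
Expanding gives one summand per choice of ends `c`, and each summand factors over the positions of
the bottom row (`sum_rowsAbove_eq_sum_endFactor`).

If two adjacent intervals select the same position, summing over its decoration produces the pair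
factor of their variables in the order opposite to the one in `pairProd`. The summand is then
symmetric in these two variables and antisymmetrizes to zero (`prod_endFactor_swap`,
`antisymmetrizer_eq_zero`). The surviving choices omit exactly one position `m`. They are the terms
of the larger antisymmetrizer in which `x` stands at position `m` (`pairProd_mul_prod_endFactor`,
`antisymmetrizer_succ`). The remaining prefactor supplies the new Vandermonde factors. -/

namespace ArrowDecoration

/-! ### Weight contributions of decorations -/

instance : Fintype ArrowDecoration :=
  ⟨{empty, nw, ne, nwne}, fun d => by cases d <;> simp⟩

theorem sum_univ {M : Type*} [AddCommMonoid M] (f : ArrowDecoration → M) :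
    ∑ d, f d = f empty + (f nw + (f ne + f nwne)) := by
  change ∑ d ∈ ({empty, nw, ne, nwne} : Finset ArrowDecoration), f d = _
  simp

variable {K : Type*} [Field K]

/-- The contribution of a decoration to the weight, apart from the row variable. -/
def coeff (t u v w : K) : ArrowDecoration → K
  | empty => t
  | nw => v
  | ne => u
  | nwne => w

/-- The contribution of a decoration to the exponent of the row variable. -/
def shift : ArrowDecoration → ℤ
  | empty => 0
  | nw => -1
  | ne => 1
  | nwne => 0

theorem prod_coeff (t u v w : K) {m : ℕ} (d : Fin m → ArrowDecoration) :
    ∏ j, coeff t u v w (d j) =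
      t ^ (Finset.univ.filter fun j => d j = empty).card
        * u ^ (Finset.univ.filter fun j => d j = ne).card
        * v ^ (Finset.univ.filter fun j => d j = nw).card
        * w ^ (Finset.univ.filter fun j => d j = nwne).card := by
  simp only [Finset.card_filter, ← Finset.prod_pow_eq_pow_sum, ← Finset.prod_mul_distrib]
  refine Finset.prod_congr rfl fun j _ => ?_
  cases d j <;> simp [coeff]

theorem sum_shift {m : ℕ} (d : Fin m → ArrowDecoration) :
    ∑ j, shift (d j) =
      ((Finset.univ.filter fun j => d j = ne).card : ℤ)
        - ((Finset.univ.filter fun j => d j = nw).card : ℤ) := by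
  simp only [Finset.card_filter, Nat.cast_sum, ← Finset.sum_sub_distrib]
  refine Finset.sum_congr rfl fun j _ => ?_
  cases d j <;> simp [shift]

end ArrowDecoration

/-- The sign attached to the signed interval of `a` and `b`. -/
def intervalSign (a b : ℤ) : ℤ := if b < a - 1 then -1 else 1

/-! ### Geometric sums over signed intervals -/

section GeometricSum

variable {K : Type*} [Field K]

theorem sum_Ico_zpow_mul_sub_one {z : K} (hz : z ≠ 0) {a b : ℤ} (hab : a ≤ b) :
    (∑ l ∈ Finset.Ico a b, z ^ l) * (z - 1) = z ^ b - z ^ a := by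
  induction b, hab using Int.leInduction with
  | base => simp
  | succ b hab ih =>
    have h : Finset.Ico a (b + 1) = insert b (Finset.Ico a b) := by ext; simp; omega
    rw [h, Finset.sum_insert (by simp), add_mul, ih, zpow_add_one₀ hz]
    ring

/-- The sign convention makes the geometric sum formula uniform: a negative interval telescopes to
the opposite difference, and for `b = a - 1` both sides vanish. -/
theorem sum_signedInterval_zpow {z : K} (hz : z ≠ 0) (hz1 : z ≠ 1) (a b : ℤ) :
    ∑ l ∈ signedInterval a b, (intervalSign a b : K) * z ^ l
      = (z - 1)⁻¹ * (z ^ (b + 1) - z ^ a) := by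
  have h1 : z - 1 ≠ 0 := sub_ne_zero.2 hz1
  rw [eq_inv_mul_iff_mul_eq₀ h1, mul_comm, ← Finset.mul_sum, mul_assoc]
  rcases le_or_gt a b with hab | hab
  · have h : Finset.Icc a b = Finset.Ico a (b + 1) := by
      ext; simp only [Finset.mem_Icc, Finset.mem_Ico]; omega
    rw [signedInterval, intervalSign, if_pos hab, if_neg (by omega), h,
      sum_Ico_zpow_mul_sub_one hz (by omega)]
    simp
  · rw [signedInterval, if_neg (not_le.2 hab), intervalSign]
    rcases eq_or_ne b (a - 1) with h2 | h2
    · simp [h2]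
    · have h : Finset.Icc (b + 1) (a - 1) = Finset.Ico (b + 1) a := by
        ext; simp only [Finset.mem_Icc, Finset.mem_Ico]; omega
      rw [if_neg h2, if_pos (show b < a - 1 by omega), h, sum_Ico_zpow_mul_sub_one hz (by omega)]
      simp

end GeometricSum

/-! ### Expansion over choices of interval ends -/

section Expansion

variable {K : Type*} [Field K] {n : ℕ}

/-- The entry of the row below whose value is selected at the end `c j` of the interval of
entry `j` (`true` stands for the right end). -/
def selectedEnd (c : Fin n → Bool) (j : Fin n) : Fin (n + 1) :=
  if c j then j.succ else j.castSucc

/-- The power of `z` contributed by one end of an interval, with `b = true` for the right end. -/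
def endPower (b : Bool) (k : ℤ) (e : ArrowDecoration) (z : K) : K :=
  if b then z ^ (rightEnd k e + 1) else z ^ leftEnd k e

/-- The factor of the summand belonging to the choice `c` of interval ends that comes from
position `p` of the row below. -/
noncomputable def endFactor (t u v w x : K) (k : Fin (n + 1) → ℤ) (c : Fin n → Bool)
    (Y : Fin n → K) (p : Fin (n + 1)) : K :=
  ∑ e : ArrowDecoration, e.coeff t u v w * x ^ (k p + e.shift)
    * ∏ j, if selectedEnd c j = p then endPower (c j) (k p) e (Y j / x) else 1

/-- The contribution of the bottom row `k` with decorations `d` to the weight, where `l` is the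
row above. -/
def rowWeight (t u v w x : K) (k : Fin (n + 1) → ℤ) (d : Fin (n + 1) → ArrowDecoration)
    (l : Fin n → ℤ) : K :=
  (∏ j : Fin n, (intervalSign (leftEnd (k j.castSucc) (d j.castSucc))
      (rightEnd (k j.succ) (d j.succ)) : K))
    * (∏ p, (d p).coeff t u v w) * x ^ (∑ p, k p - ∑ j, l j + ∑ p, (d p).shift)

/-- The possible rows above the row `k` with decorations `d`. -/
noncomputable def rowsAbove (k : Fin (n + 1) → ℤ) (d : Fin (n + 1) → ArrowDecoration) :
    Finset (Fin n → ℤ) :=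
  Fintype.piFinset fun j => signedInterval (leftEnd (k j.castSucc) (d j.castSucc))
      (rightEnd (k j.succ) (d j.succ))

theorem zpow_sum {ι : Type*} (s : Finset ι) {x : K} (hx : x ≠ 0) (f : ι → ℤ) :
    x ^ (∑ i ∈ s, f i) = ∏ i ∈ s, x ^ f i := by
  classical
  induction s using Finset.induction_on with
  | empty => simp
  | insert a s ha ih => rw [Finset.sum_insert ha, Finset.prod_insert ha, zpow_add₀ hx, ih]

/-- The exponent of `x` contains `-l j`, which turns `Y j ^ l j` into a power of `Y j / x`; the sum
over `l` then splits into independent geometric sums. -/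
theorem sum_rowsAbove (t u v w : K) {x : K} (hx : x ≠ 0) (k : Fin (n + 1) → ℤ)
    (d : Fin (n + 1) → ArrowDecoration) (Y : Fin n → K) (hY : ∀ j, Y j ≠ 0)
    (hYx : ∀ j, Y j ≠ x) :
    ∑ l ∈ rowsAbove k d, rowWeight t u v w x k d l * ∏ j, Y j ^ (l j - 1)
      = (∏ j, (Y j * (Y j / x - 1)))⁻¹ *
        ((∏ p, ((d p).coeff t u v w * x ^ (k p + (d p).shift))) *
          ∏ j : Fin n, ((Y j / x) ^ (rightEnd (k j.succ) (d j.succ) + 1)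
            - (Y j / x) ^ leftEnd (k j.castSucc) (d j.castSucc))) := by
  have h : ∀ j : Fin n, (Y j / x) ^ (rightEnd (k j.succ) (d j.succ) + 1)
            - (Y j / x) ^ leftEnd (k j.castSucc) (d j.castSucc)
      = (Y j / x - 1) * ∑ l ∈ signedInterval (leftEnd (k j.castSucc) (d j.castSucc))
          (rightEnd (k j.succ) (d j.succ)),
          (intervalSign (leftEnd (k j.castSucc) (d j.castSucc))
            (rightEnd (k j.succ) (d j.succ)) : K) * (Y j / x) ^ l := by
    intro j
    have h1 : Y j / x ≠ 1 := by rw [Ne, div_eq_one_iff_eq hx]; exact hYx j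
    rw [sum_signedInterval_zpow (div_ne_zero (hY j) hx) h1,
      mul_inv_cancel_left₀ (sub_ne_zero.2 h1)]
  have hne : ∀ j, Y j / x - 1 ≠ 0 := fun j => by
    rw [sub_ne_zero, Ne, div_eq_one_iff_eq hx]; exact hYx j
  simp only [h]
  rw [Finset.prod_mul_distrib (f := fun j => Y j / x - 1),
    Finset.prod_mul_distrib (f := fun j => Y j), Finset.prod_univ_sum, mul_inv]
  change _ = _ * (_ * (_ * ∑ l ∈ rowsAbove k d, _))
  rw [mul_left_comm (∏ p, _), mul_assoc (∏ j, Y j)⁻¹,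
    inv_mul_cancel_left₀ (Finset.prod_ne_zero_iff.2 fun j _ => hne j), Finset.mul_sum,
    Finset.mul_sum]
  refine Finset.sum_congr rfl fun l _ => ?_
  have e1 : ∑ p, k p - ∑ j, l j + ∑ p, (d p).shift
      = ∑ p, (k p + (d p).shift) - ∑ j, l j := by
    rw [Finset.sum_add_distrib]; ring
  rw [rowWeight, e1, zpow_sub₀ hx, zpow_sum _ hx, zpow_sum _ hx]
  simp only [zpow_sub_one₀ (hY _), div_zpow, Finset.prod_mul_distrib, Finset.prod_div_distrib,
    Finset.prod_inv_distrib]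
  ring

/-- Once an end is chosen for every interval, each end term depends on the decoration of a single
position, so the sum over decorations factors over positions. -/
theorem sum_rowsAbove_eq_sum_endFactor (t u v w : K) {x : K} (hx : x ≠ 0)
    (k : Fin (n + 1) → ℤ) (Y : Fin n → K) (hY : ∀ j, Y j ≠ 0) (hYx : ∀ j, Y j ≠ x) :
    ∑ d : Fin (n + 1) → ArrowDecoration, ∑ l ∈ rowsAbove k d,
        rowWeight t u v w x k d l * ∏ j, Y j ^ (l j - 1)
      = (∏ j, (Y j * (Y j / x - 1)))⁻¹ *
        ∑ c : Fin n → Bool, (∏ j, if c j then (1 : K) else -1) *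
          ∏ p, endFactor t u v w x k c Y p := by
  simp only [sum_rowsAbove t u v w hx k _ Y hY hYx, ← Finset.mul_sum]
  congr 1
  have h1 : ∀ d : Fin (n + 1) → ArrowDecoration,
      ∏ j : Fin n, ((Y j / x) ^ (rightEnd (k j.succ) (d j.succ) + 1)
            - (Y j / x) ^ leftEnd (k j.castSucc) (d j.castSucc))
        = ∑ c : Fin n → Bool, (∏ j, if c j then (1 : K) else -1) *
          ∏ p, ∏ j, if selectedEnd c j = p then endPower (c j) (k p) (d p) (Y j / x) else 1 := by
    intro d
    have h2 : ∀ j : Fin n, ((Y j / x) ^ (rightEnd (k j.succ) (d j.succ) + 1)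
            - (Y j / x) ^ leftEnd (k j.castSucc) (d j.castSucc))
        = ∑ b : Bool, (if b then (1 : K) else -1) *
          (if b then (Y j / x) ^ (rightEnd (k j.succ) (d j.succ) + 1)
            else (Y j / x) ^ leftEnd (k j.castSucc) (d j.castSucc)) := by
      intro j
      simp [sub_eq_add_neg]
    simp only [h2]
    rw [Finset.prod_univ_sum, Fintype.piFinset_univ]
    refine Finset.sum_congr rfl fun c _ => ?_
    rw [Finset.prod_mul_distrib, Finset.prod_comm (s := Finset.univ (α := Fin (n + 1)))]
    congr 1
    refine Finset.prod_congr rfl fun j _ => ?_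
    rw [Finset.prod_ite_eq]
    cases hc : c j <;> simp [selectedEnd, endPower, hc]
  simp only [h1, Finset.mul_sum, endFactor]
  rw [Finset.sum_comm]
  refine Finset.sum_congr rfl fun c _ => ?_
  rw [Finset.prod_univ_sum, Fintype.piFinset_univ, Finset.mul_sum]
  refine Finset.sum_congr rfl fun d _ => ?_
  rw [Finset.prod_mul_distrib (g := fun p => ∏ j, _)]
  ring

end Expansion

/-! ### Pair factors and cancellation of doubly selected positions -/

section Alternation

variable {K : Type*} [Field K] {n : ℕ}

/-- The symmetrized factor of a pair of variables. -/
def pairFactor (t u v w a b : K) : K := v + w * a + t * b + u * (a * b)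

/-- The product of the pair factors over all `i ≤ j`. -/
def pairProd (t u v w : K) (Y : Fin n → K) : K :=
  ∏ i, ∏ j ∈ Finset.Ici i, pairFactor t u v w (Y i) (Y j)

/-- The four decorations yield the four monomials of the pair factor. Setting `z` or `z'` to `1`
covers positions selected once or never. -/
theorem sum_coeff_mul_zpow (t u v w : K) {x z z' : K} (hx : x ≠ 0) (hz : z ≠ 0)
    (hz' : z' ≠ 0) (k : ℤ) :
    ∑ e : ArrowDecoration, e.coeff t u v w * x ^ (k + e.shift)
        * (z ^ (rightEnd k e + 1) * z' ^ leftEnd k e)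
      = x ^ (k - 1) * (z ^ k * z' ^ k) * pairFactor t u v w (x * z') (x * z) := by
  simp only [ArrowDecoration.sum_univ, ArrowDecoration.coeff, ArrowDecoration.shift, rightEnd,
    leftEnd, ArrowDecoration.pointsNW, ArrowDecoration.pointsNE, pairFactor, reduceCtorEq,
    or_self, or_true, true_or, if_true, if_false, add_zero, ← sub_eq_add_neg,
    zpow_sub_one₀ hz, zpow_add_one₀ hz, zpow_add_one₀ hz', zpow_add_one₀ hx, zpow_sub_one₀ hx]
  field_simp
  ring

theorem pairProd_eq_prod_filter (t u v w : K) (Y : Fin n → K) :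
    pairProd t u v w Y = ∏ a ∈ Finset.univ.filter (fun a : Fin n × Fin n => a.1 ≤ a.2),
      pairFactor t u v w (Y a.1) (Y a.2) := by
  rw [pairProd, Finset.prod_filter, ← Finset.univ_product_univ, Finset.prod_product]
  refine Finset.prod_congr rfl fun i _ => ?_
  rw [← Finset.prod_filter]
  exact Finset.prod_congr (by ext; simp) fun _ _ => rfl

/-- An adjacent transposition permutes all pairs `a ≤ b` except `(i, i')`. The form without division
allows vanishing pair factors. -/
theorem pairProd_swap (t u v w : K) (Y : Fin n → K) {i i' : Fin n}
    (hi : (i : ℕ) + 1 = i') :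
    pairFactor t u v w (Y i) (Y i') * pairProd t u v w (Y ∘ Equiv.swap i i')
      = pairFactor t u v w (Y i') (Y i) * pairProd t u v w Y := by
  have hmem : (i, i') ∈ Finset.univ.filter (fun a : Fin n × Fin n => a.1 ≤ a.2) := by
    simp only [Finset.mem_filter, Finset.mem_univ, true_and, Fin.le_def]; omega
  rw [pairProd_eq_prod_filter, pairProd_eq_prod_filter, ← Finset.mul_prod_erase _ _ hmem,
    ← Finset.mul_prod_erase _ _ hmem]
  have h : ∏ a ∈ (Finset.univ.filter (fun a : Fin n × Fin n => a.1 ≤ a.2)).erase (i, i'),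
        pairFactor t u v w ((Y ∘ Equiv.swap i i') a.1) ((Y ∘ Equiv.swap i i') a.2)
      = ∏ a ∈ (Finset.univ.filter (fun a : Fin n × Fin n => a.1 ≤ a.2)).erase (i, i'),
        pairFactor t u v w (Y a.1) (Y a.2) := by
    refine Finset.prod_equiv (Equiv.prodCongr (Equiv.swap i i') (Equiv.swap i i'))
      (fun a => ?_) (fun a _ => rfl)
    obtain ⟨a, b⟩ := a
    simp only [Finset.mem_erase, Finset.mem_filter, Finset.mem_univ, true_and, ne_eq,
      Prod.mk.injEq, Equiv.prodCongr_apply, Prod.map_apply, Equiv.swap_apply_def, Fin.le_def,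
      Fin.ext_iff]
    split_ifs <;> omega
  rw [h]
  simp only [Function.comp_apply, Equiv.swap_apply_left, Equiv.swap_apply_right]
  ring

theorem selectedEnd_val (c : Fin n → Bool) (j : Fin n) :
    (selectedEnd c j : ℕ) = if c j then (j : ℕ) + 1 else j := by
  unfold selectedEnd; split_ifs <;> simp

theorem prod_endFactor_swap (t u v w : K) {x : K} (hx : x ≠ 0) (k : Fin (n + 1) → ℤ)
    (c : Fin n → Bool) {Y : Fin n → K} (hY : ∀ j, Y j ≠ 0) {i i' : Fin n}
    (hi : (i : ℕ) + 1 = i') (hc : c i = true) (hc' : c i' = false) :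
    pairProd t u v w (Y ∘ Equiv.swap i i')
        * ∏ p, endFactor t u v w x k c (Y ∘ Equiv.swap i i') p
      = pairProd t u v w Y * ∏ p, endFactor t u v w x k c Y p := by
  have hne : i ≠ i' := by rintro rfl; omega
  have key : ∀ Z : Fin n → K, (∀ j, Z j ≠ 0) → endFactor t u v w x k c Z i.succ
      = x ^ (k i.succ - 1) * ((Z i / x) ^ k i.succ * (Z i' / x) ^ k i.succ)
        * pairFactor t u v w (Z i') (Z i) := by
    intro Z hZ
    have h1 : ∀ e, (∏ j, if selectedEnd c j = i.succ then
        endPower (c j) (k i.succ) e (Z j / x) else 1)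
        = (Z i / x) ^ (rightEnd (k i.succ) e + 1) * (Z i' / x) ^ leftEnd (k i.succ) e := by
      intro e
      rw [Fintype.prod_eq_mul i i' hne]
      · rw [if_pos, if_pos]
        · simp [endPower, hc, hc']
        · ext; rw [selectedEnd_val, hc']; simp [hi]
        · ext; rw [selectedEnd_val, hc]; simp
      · rintro j ⟨hj, hj'⟩
        rw [if_neg]
        rw [Fin.ext_iff, selectedEnd_val]
        rw [Ne, Fin.ext_iff] at hj hj'
        split_ifs <;> simp <;> omega
    simp only [endFactor, h1]
    rw [sum_coeff_mul_zpow t u v w hx (div_ne_zero (hZ i) hx) (div_ne_zero (hZ i') hx),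
      mul_div_cancel₀ _ hx, mul_div_cancel₀ _ hx]
  -- Both intervals `i` and `i'` select position `i.succ`, so no other factor sees their variables.
  have other : ∀ p ≠ i.succ, endFactor t u v w x k c (Y ∘ Equiv.swap i i') p
      = endFactor t u v w x k c Y p := by
    intro p hp
    unfold endFactor
    refine Finset.sum_congr rfl fun e _ => ?_
    congr 1
    refine Finset.prod_congr rfl fun j _ => ?_
    split_ifs with hj
    · have h1 : j ≠ i := by
        rintro rfl
        exact hp (by rw [← hj]; simp [selectedEnd, hc])
      have h2 : j ≠ i' := by
        rintro rfl
        exact hp (by rw [← hj]; ext; simp [selectedEnd, hc', hi])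
      rw [Function.comp_apply, Equiv.swap_apply_of_ne_of_ne h1 h2]
    · rfl
  rw [← Finset.mul_prod_erase _ _ (Finset.mem_univ i.succ),
    ← Finset.mul_prod_erase _ _ (Finset.mem_univ i.succ),
    Finset.prod_congr rfl fun p hp => other p (Finset.ne_of_mem_erase hp),
    key Y hY, key (Y ∘ Equiv.swap i i') fun j => hY _]
  simp only [Function.comp_apply, Equiv.swap_apply_left, Equiv.swap_apply_right]
  linear_combination (x ^ (k i.succ - 1) * ((Y i / x) ^ k i.succ * (Y i' / x) ^ k i.succ)
    * ∏ p ∈ Finset.univ.erase i.succ, endFactor t u v w x k c Y p)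
      * pairProd_swap t u v w Y hi

/-- Terms are cancelled in pairs, which avoids dividing by 2 and so works in every characteristic.
-/
theorem antisymmetrizer_eq_zero {f : (Fin n → K) → K} {X : Fin n → K} {i i' : Fin n}
    (hne : i ≠ i')
    (hf : ∀ σ : Equiv.Perm (Fin n), f ((X ∘ σ) ∘ Equiv.swap i i') = f (X ∘ σ)) :
    antisymmetrizer f X = 0 := by
  refine Finset.sum_involution (fun σ _ => σ * Equiv.swap i i') ?_ ?_ ?_ ?_
  · intro σ _
    have h := hf σ
    change _ + _ * f ((X ∘ σ) ∘ Equiv.swap i i') = 0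
    rw [h, map_mul, Equiv.Perm.sign_swap hne]
    simp [Function.comp_def]
  · intro σ _ _ h
    exact hne (Equiv.swap_eq_one_iff.1 (mul_eq_left.1 h))
  · simp
  · intro σ _
    simp [mul_assoc]

/-! ### The surviving choices of ends -/

/-- The choice of ends that avoids position `m` of the row below. -/
def endsAvoiding (m : Fin (n + 1)) (j : Fin n) : Bool := decide (m ≤ j.castSucc)

theorem selectedEnd_endsAvoiding (m : Fin (n + 1)) (j : Fin n) :
    selectedEnd (endsAvoiding m) j = m.succAbove j := by
  unfold selectedEnd endsAvoiding Fin.succAbove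
  split_ifs with h1 h2 h2 <;> simp_all
  exact absurd h1 (not_le.2 h2)

theorem endsAvoiding_injective : Function.Injective (endsAvoiding (n := n)) := by
  intro m m' h
  wlog hlt : m < m' generalizing m m'
  · rcases lt_trichotomy m m' with h1 | h1 | h1
    · exact this h h1
    · exact h1
    · exact (this h.symm h1).symm
  -- At the smaller threshold the two choices differ.
  have h1 := congrFun h ⟨m, by omega⟩
  simp only [endsAvoiding, decide_eq_decide, Fin.le_def, Fin.val_castSucc] at h1
  omega

/-- A Boolean sequence without a `true` directly followed by `false` is monotone, hence given by a
threshold. -/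
theorem exists_eq_endsAvoiding (c : Fin n → Bool)
    (hc : ∀ i i' : Fin n, (i : ℕ) + 1 = i' → c i = true → c i' = true) :
    ∃ m, c = endsAvoiding m := by
  induction n with
  | zero => exact ⟨0, Subsingleton.elim _ _⟩
  | succ n ih =>
    obtain ⟨m, hm⟩ := ih (fun j => c j.castSucc) fun i i' h => hc _ _ (by simpa using h)
    rcases hl : c (Fin.last n) with _ | _
    · refine ⟨Fin.last _, funext fun j => ?_⟩
      -- A final `false` propagates to the left; `r` is the distance from the end.
      have h1 : ∀ r : ℕ, ∀ i : Fin (n + 1), (i : ℕ) + r = n → c i = false := by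
        intro r
        induction r with
        | zero => intro i hi; rw [← hl]; congr 1; ext; simpa using hi
        | succ r ihr =>
          intro i hi
          by_contra h2
          have h3 := hc i ⟨i + 1, by omega⟩ rfl (by simpa using h2)
          rw [ihr ⟨i + 1, by omega⟩ (by simp; omega)] at h3
          cases h3
      rw [h1 (n - j) j (by omega), eq_comm, endsAvoiding, decide_eq_false_iff_not]
      simp [Fin.le_def]; omega
    · refine ⟨m.castSucc, funext fun j => ?_⟩
      refine Fin.lastCases ?_ (fun j => ?_) j
      · rw [hl, eq_comm, endsAvoiding, decide_eq_true_iff]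
        simp [Fin.le_def]; omega
      · rw [congrFun hm j]
        simp [endsAvoiding]

theorem sum_bool_eq_sum_endsAvoiding {M : Type*} [AddCommMonoid M] (f : (Fin n → Bool) → M)
    (hf : ∀ c, ∀ i i' : Fin n, (i : ℕ) + 1 = i' → c i = true → c i' = false → f c = 0) :
    ∑ c, f c = ∑ m, f (endsAvoiding m) := by
  classical
  rw [← Finset.sum_image fun _ _ _ _ h => endsAvoiding_injective h]
  refine (Finset.sum_subset (Finset.subset_univ _) fun c _ hc => ?_).symm
  by_contra h
  refine hc ?_
  obtain ⟨m, rfl⟩ := exists_eq_endsAvoiding c fun i i' hi h1 => by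
    by_contra h2
    exact h (hf c i i' hi h1 (by simpa using h2))
  exact Finset.mem_image_of_mem _ (Finset.mem_univ _)

theorem prod_sign_endsAvoiding (m : Fin (n + 1)) :
    (∏ j, if endsAvoiding m j then (1 : K) else -1) = (-1) ^ (m : ℕ) := by
  rw [Finset.prod_ite, Finset.prod_const_one, one_mul, Finset.prod_const]
  congr 1
  have h : (Finset.univ.filter fun j => ¬ endsAvoiding m j = true)
      = Finset.univ.filter fun j : Fin n => (j : ℕ) < m := by
    ext j; simp [endsAvoiding, Fin.lt_def]
  rw [h, Fin.card_filter_val_lt]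
  omega

/-- The new pairs are `x` with itself and `x` with each `Y j`, where `x` comes first exactly when `m
≤ j.castSucc`. -/
theorem pairProd_insertNth (t u v w x : K) (m : Fin (n + 1)) (Y : Fin n → K) :
    pairProd t u v w (m.insertNth x Y : Fin (n + 1) → K)
      = pairFactor t u v w x x
        * (∏ j, if endsAvoiding m j then pairFactor t u v w x (Y j)
            else pairFactor t u v w (Y j) x) * pairProd t u v w Y := by
  have h : ∀ {r : ℕ} (Z : Fin r → K), pairProd t u v w Z
      = ∏ i, ∏ j, if i ≤ j then pairFactor t u v w (Z i) (Z j) else 1 := by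
    intro r Z
    rw [pairProd]
    refine Finset.prod_congr rfl fun i _ => ?_
    rw [← Finset.prod_filter]
    exact Finset.prod_congr (by ext; simp) fun _ _ => rfl
  have h2 : ∀ j : Fin n, (if m ≤ m.succAbove j then pairFactor t u v w x (Y j) else 1)
      * (if m.succAbove j ≤ m then pairFactor t u v w (Y j) x else 1)
      = if endsAvoiding m j then pairFactor t u v w x (Y j)
            else pairFactor t u v w (Y j) x := by
    intro j
    rcases lt_or_ge j.castSucc m with h1 | h1
    · rw [Fin.succAbove_of_castSucc_lt _ _ h1]
      simp [endsAvoiding, h1.le, not_le.2 h1]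
    · rw [Fin.succAbove_of_le_castSucc _ _ h1]
      have h3 : m < j.succ := h1.trans_lt (Fin.castSucc_lt_succ)
      simp [endsAvoiding, h1, h3, h3.le]
  rw [h, h, Fin.prod_univ_succAbove _ m, Fin.prod_univ_succAbove _ m]
  simp only [Fin.prod_univ_succAbove _ m, Fin.insertNth_apply_same,
    Fin.insertNth_apply_succAbove, Fin.succAbove_le_succAbove_iff, Finset.prod_mul_distrib, ← h2,
    le_refl, if_true]
  ring

/-- Position `m` is never selected and contributes the pair factor of `x` with itself; every other
position is selected once and pairs its variable with `x`, in the order required by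
`pairProd_insertNth`. -/
theorem pairProd_mul_prod_endFactor (t u v w : K) {x : K} (hx : x ≠ 0)
    (k : Fin (n + 1) → ℤ) (m : Fin (n + 1)) {Y : Fin n → K} (hY : ∀ j, Y j ≠ 0) :
    pairProd t u v w Y * ∏ p, endFactor t u v w x k (endsAvoiding m) Y p
      = (∏ j, (Y j / x)) * (pairProd t u v w (m.insertNth x Y : Fin (n + 1) → K)
        * ∏ p, (m.insertNth x Y : Fin (n + 1) → K) p ^ (k p - 1)) := by
  have h0 : endFactor t u v w x k (endsAvoiding m) Y m
      = x ^ (k m - 1) * pairFactor t u v w x x := by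
    have := sum_coeff_mul_zpow t u v w hx one_ne_zero one_ne_zero (k m)
    simpa [endFactor, selectedEnd_endsAvoiding, Fin.succAbove_ne] using this
  have h1 : ∀ j, endFactor t u v w x k (endsAvoiding m) Y (m.succAbove j)
      = (Y j / x) * Y j ^ (k (m.succAbove j) - 1)
        * if endsAvoiding m j then pairFactor t u v w x (Y j)
            else pairFactor t u v w (Y j) x := by
    intro j
    have hz := div_ne_zero (hY j) hx
    have h2 : ∀ κ : ℤ, Y j / x * Y j ^ (κ - 1) = x ^ (κ - 1) * (Y j / x) ^ κ := by
      intro κ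
      rw [zpow_sub_one₀ hx, zpow_sub_one₀ (hY j), div_zpow]
      have := zpow_ne_zero κ hx
      have := hY j
      field_simp
    simp only [endFactor, selectedEnd_endsAvoiding, Fin.succAbove_right_inj, Finset.prod_ite_eq',
      Finset.mem_univ, if_true, h2]
    cases hb : endsAvoiding m j
    · have := sum_coeff_mul_zpow t u v w hx one_ne_zero hz (k (m.succAbove j))
      simpa [endPower, mul_div_cancel₀ _ hx] using this
    · have := sum_coeff_mul_zpow t u v w hx hz one_ne_zero (k (m.succAbove j))
      simpa [endPower, mul_div_cancel₀ _ hx] using this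
  rw [Fin.prod_univ_succAbove _ m, Fin.prod_univ_succAbove _ m, h0, pairProd_insertNth]
  simp only [h1, Finset.prod_mul_distrib, Fin.insertNth_apply_same,
    Fin.insertNth_apply_succAbove]
  ring

/-! ### Expansion of the antisymmetrizer along the last variable -/

/-- The permutation of `n + 1` elements that takes the value `n` at `m` and lists the values of `τ`
at the other positions. -/
def insertLast (m : Fin (n + 1)) (τ : Equiv.Perm (Fin n)) : Equiv.Perm (Fin (n + 1)) :=
  (Fin.last n).cycleRange.symm * (Equiv.Perm.decomposeFin.symm (0, τ) * m.cycleRange)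

theorem insertLast_self (m : Fin (n + 1)) (τ : Equiv.Perm (Fin n)) :
    insertLast m τ m = Fin.last n := by
  rw [insertLast, Equiv.Perm.mul_apply, Equiv.Perm.mul_apply, Fin.cycleRange_self,
    Equiv.Perm.decomposeFin_symm_apply_zero, Fin.cycleRange_symm_zero]

theorem insertLast_succAbove (m : Fin (n + 1)) (τ : Equiv.Perm (Fin n)) (j : Fin n) :
    insertLast m τ (m.succAbove j) = (τ j).castSucc := by
  rw [insertLast, Equiv.Perm.mul_apply, Equiv.Perm.mul_apply, Fin.cycleRange_succAbove,
    Equiv.Perm.decomposeFin_symm_apply_succ, Equiv.swap_self, Equiv.refl_apply,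
    Fin.cycleRange_symm_succ, Fin.succAbove_last]

theorem sign_insertLast (m : Fin (n + 1)) (τ : Equiv.Perm (Fin n)) :
    Equiv.Perm.sign (insertLast m τ) = (-1) ^ n * (-1) ^ (m : ℕ) * Equiv.Perm.sign τ := by
  simp [insertLast, Fin.sign_cycleRange, Equiv.Perm.decomposeFin.symm_sign, mul_comm, mul_assoc]

theorem insertLast_bijective : Function.Bijective
    fun a : Fin (n + 1) × Equiv.Perm (Fin n) => insertLast a.1 a.2 := by
  rw [Fintype.bijective_iff_injective_and_card]
  constructor
  · rintro ⟨m, τ⟩ ⟨m', τ'⟩ h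
    have h : insertLast m τ = insertLast m' τ' := h
    obtain rfl : m = m' := by
      apply (insertLast m τ).injective
      conv_rhs => rw [h]
      rw [insertLast_self, insertLast_self]
    congr 1
    ext j
    have := congrArg Fin.val (Equiv.congr_fun h (m.succAbove j))
    simpa [insertLast_succAbove] using this
  · simp [Fintype.card_perm, Nat.factorial_succ]

/-- Permutations are grouped by the position `m` of the last variable, as in a Laplace expansion. -/
theorem antisymmetrizer_succ (f : (Fin (n + 1) → K) → K) (X : Fin (n + 1) → K) :
    antisymmetrizer f X = (-1) ^ n * ∑ m : Fin (n + 1), (-1) ^ (m : ℕ) *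
      antisymmetrizer (fun Y => f (m.insertNth (X (Fin.last n)) Y)) fun j => X j.castSucc := by
  simp only [antisymmetrizer, Finset.mul_sum]
  rw [← Fintype.sum_prod_type', ← insertLast_bijective.sum_comp]
  refine Finset.sum_congr rfl fun a _ => ?_
  have h : (fun i => X (insertLast a.1 a.2 i))
      = (a.1.insertNth (X (Fin.last n)) fun j => X (a.2 j).castSucc : Fin (n + 1) → K) := by
    funext i
    refine Fin.succAboveCases a.1 ?_ (fun j => ?_) i
    · simp [insertLast_self]
    · simp [insertLast_succAbove]
  rw [h, sign_insertLast]
  push_cast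
  ring

end Alternation

/-! ### The recursion for the antisymmetrized numerator -/

section RowSum

variable {K : Type*} [Field K] {n : ℕ}

/-- The function whose antisymmetrizer is the numerator. -/
def numerator (t u v w : K) (k : Fin n → ℤ) (Y : Fin n → K) : K :=
  pairProd t u v w Y * ∏ i, Y i ^ (k i - 1)

theorem antisymmetrizer_mul_left {f g : (Fin n → K) → K} {X : Fin n → K} {a : K}
    (h : ∀ σ : Equiv.Perm (Fin n), f (X ∘ σ) = a * g (X ∘ σ)) :
    antisymmetrizer f X = a * antisymmetrizer g X := by
  rw [antisymmetrizer, antisymmetrizer, Finset.mul_sum]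
  refine Finset.sum_congr rfl fun σ _ => ?_
  have := h σ
  simp only [Function.comp_def] at this
  rw [this]
  ring

theorem antisymmetrizer_sum {ι : Type*} (s : Finset ι) (f : ι → (Fin n → K) → K)
    (X : Fin n → K) :
    antisymmetrizer (fun Y => ∑ i ∈ s, f i Y) X = ∑ i ∈ s, antisymmetrizer (f i) X := by
  simp only [antisymmetrizer, Finset.mul_sum]
  exact Finset.sum_comm

theorem sum_rowWeight_mul_antisymmetrizer (t u v w : K) (k : Fin (n + 1) → ℤ)
    (X : Fin (n + 1) → K) (hX0 : ∀ i, X i ≠ 0) (hX : Function.Injective X) :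
    ∑ d : Fin (n + 1) → ArrowDecoration, ∑ l ∈ rowsAbove k d,
        rowWeight t u v w (X (Fin.last n)) k d l
          * antisymmetrizer (numerator t u v w l) (fun j => X j.castSucc)
      = (∏ j : Fin n, (X (Fin.last n) - X j.castSucc))⁻¹
        * antisymmetrizer (numerator t u v w k) X := by
  set x := X (Fin.last n) with hx_def
  set X' : Fin n → K := fun j => X j.castSucc with hX'_def
  have hx : x ≠ 0 := hX0 _
  have hX'0 : ∀ j, X' j ≠ 0 := fun j => hX0 _
  have hX'x : ∀ j, X' j ≠ x := fun j h => (Fin.castSucc_lt_last j).ne (hX h)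
  calc
    _ = antisymmetrizer (fun Y => ∑ d : Fin (n + 1) → ArrowDecoration, ∑ l ∈ rowsAbove k d,
          rowWeight t u v w x k d l * numerator t u v w l Y) X' := by
      simp only [antisymmetrizer_sum]
      refine Finset.sum_congr rfl fun d _ => Finset.sum_congr rfl fun l _ => ?_
      exact (antisymmetrizer_mul_left fun σ => rfl).symm
    _ = (∏ j, (X' j * (X' j / x - 1)))⁻¹ * antisymmetrizer (fun Y =>
          ∑ c : Fin n → Bool, (∏ j, if c j then (1 : K) else -1) *
            (pairProd t u v w Y * ∏ p, endFactor t u v w x k c Y p)) X' := by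
      refine antisymmetrizer_mul_left fun σ => ?_
      have h := sum_rowsAbove_eq_sum_endFactor t u v w hx k (X' ∘ σ) (fun j => hX'0 _)
        fun j => hX'x _
      -- The prefactor is symmetric, so it leaves the antisymmetrizer.
      have h1 : ∏ j, ((X' ∘ σ) j * ((X' ∘ σ) j / x - 1)) = ∏ j, (X' j * (X' j / x - 1)) :=
        Equiv.prod_comp σ fun j => X' j * (X' j / x - 1)
      rw [h1] at h
      simp only [numerator, mul_left_comm _ (pairProd t u v w (X' ∘ σ)), ← Finset.mul_sum, h]
    _ = (∏ j, (X' j * (X' j / x - 1)))⁻¹ * ∑ m : Fin (n + 1), (-1) ^ (m : ℕ) *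
          antisymmetrizer (fun Y =>
            pairProd t u v w Y * ∏ p, endFactor t u v w x k (endsAvoiding m) Y p) X' := by
      rw [antisymmetrizer_sum, sum_bool_eq_sum_endsAvoiding]
      · congr 1
        refine Finset.sum_congr rfl fun m _ => ?_
        exact antisymmetrizer_mul_left fun σ => by rw [prod_sign_endsAvoiding]
      · intro c i i' hi hc hc'
        refine antisymmetrizer_eq_zero (i := i) (i' := i') (by rintro rfl; omega) fun σ => ?_
        congr 1
        exact prod_endFactor_swap t u v w hx k c (fun j => hX'0 _) hi hc hc'
    _ = (∏ j, (X' j * (X' j / x - 1)))⁻¹ * ((∏ j, (X' j / x)) * ∑ m : Fin (n + 1),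
          (-1) ^ (m : ℕ) * antisymmetrizer (fun Y =>
            numerator t u v w k (m.insertNth x Y : Fin (n + 1) → K)) X') := by
      congr 1
      rw [Finset.mul_sum]
      refine Finset.sum_congr rfl fun m _ => ?_
      rw [mul_left_comm]
      congr 1
      refine antisymmetrizer_mul_left fun σ => ?_
      rw [pairProd_mul_prod_endFactor t u v w hx k m (Y := X' ∘ σ) fun j => hX'0 _, numerator]
      congr 1
      exact Equiv.prod_comp σ fun j => X' j / x
    _ = _ := by
      rw [antisymmetrizer_succ, ← mul_assoc, ← mul_assoc]
      congr 1
      -- The sign from `antisymmetrizer_succ` turns each `X' j - x` into `x - X' j`.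
      have h2 : ((-1 : K)) ^ n = ∏ _j : Fin n, (-1) := by simp
      rw [h2, ← Finset.prod_inv_distrib, ← Finset.prod_inv_distrib, ← Finset.prod_mul_distrib,
        ← Finset.prod_mul_distrib]
      refine Finset.prod_congr rfl fun j _ => ?_
      have h3 := hX'0 j
      have h4 : X' j - x ≠ 0 := sub_ne_zero.2 (hX'x j)
      have h5 : x - X' j ≠ 0 := sub_ne_zero.2 (hX'x j).symm
      have h6 : X' j / x - 1 = (X' j - x) / x := by field_simp
      change _ = (x - X' j)⁻¹ * -1
      rw [h6]
      field_simp
      ring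

end RowSum

/-! ### Removing the bottom row of a pattern -/

namespace ArrowedGTPattern

variable {n : ℕ}

/-- The pattern formed by all rows but the bottom one. -/
def truncate (A : ArrowedGTPattern (n + 1)) : ArrowedGTPattern n where
  entry i j := A.entry i.castSucc j
  decor i j := A.decor i.castSucc j
  entry_mem i j := A.entry_mem i.castSucc j

/-- The decorations of the bottom row. -/
def bottomDecor (A : ArrowedGTPattern n) : Fin n → ArrowDecoration := A.decor (Fin.last n)

theorem ext_of_truncate {A B : ArrowedGTPattern (n + 1)} (h : A.truncate = B.truncate)
    (hr : A.bottomRow = B.bottomRow) (hd : A.bottomDecor = B.bottomDecor) : A = B := by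
  ext i j
  · refine Fin.lastCases (motive := fun i => ∀ j, A.entry i j = B.entry i j) ?_ ?_ i j
    · exact fun j => congrFun hr j
    · intro i j
      exact congrArg (fun C : ArrowedGTPattern n => C.entry i j) h
  · refine Fin.lastCases (motive := fun i => ∀ j, A.decor i j = B.decor i j) ?_ ?_ i j
    · exact fun j => congrFun hd j
    · intro i j
      exact congrArg (fun C : ArrowedGTPattern n => C.decor i j) h

theorem bottomRow_truncate_mem (A : ArrowedGTPattern (n + 1)) :
    A.truncate.bottomRow ∈ rowsAbove A.bottomRow A.bottomDecor :=
  Fintype.mem_piFinset.2 fun j => A.entry_mem (Fin.last n) j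

theorem exists_truncate_eq (k : Fin (n + 1) → ℤ) (d : Fin (n + 1) → ArrowDecoration)
    (B : ArrowedGTPattern n) (hB : B.bottomRow ∈ rowsAbove k d) :
    ∃ A : ArrowedGTPattern (n + 1),
      A.bottomRow = k ∧ A.bottomDecor = d ∧ A.truncate = B := by
  let e : (i : Fin (n + 2)) → Fin (i : ℕ) → ℤ :=
    Fin.lastCases (motive := fun i => Fin (i : ℕ) → ℤ) k B.entry
  let f : (i : Fin (n + 2)) → Fin (i : ℕ) → ArrowDecoration :=
    Fin.lastCases (motive := fun i => Fin (i : ℕ) → ArrowDecoration) d B.decor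
  have he : e (Fin.last _) = k := Fin.lastCases_last
  have hf : f (Fin.last _) = d := Fin.lastCases_last
  have he' : ∀ i : Fin (n + 1), e i.castSucc = B.entry i := fun i => Fin.lastCases_castSucc _
  have hf' : ∀ i : Fin (n + 1), f i.castSucc = B.decor i := fun i => Fin.lastCases_castSucc _
  refine ⟨⟨e, f, fun i => ?_⟩, he, hf, ?_⟩
  · refine Fin.lastCases ?_ (fun i => ?_) i
    · have h := Fintype.mem_piFinset.1 hB
      intro j
      have h1 := h j
      change e (Fin.last n).castSucc j ∈ signedInterval
        (leftEnd (e (Fin.last (n + 1)) j.castSucc) (f (Fin.last (n + 1)) j.castSucc))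
        (rightEnd (e (Fin.last (n + 1)) j.succ) (f (Fin.last (n + 1)) j.succ))
      rw [he', he, hf]
      exact h1
    · intro j
      have h1 := B.entry_mem i j
      rw [← he', ← he', ← hf'] at h1
      exact h1
  · ext i j
    · exact congrFun (he' i) j
    · exact congrFun (hf' i) j

theorem weight_eq {K : Type*} [Field K] (t u v w : K) (X : Fin n → K)
    (A : ArrowedGTPattern n) :
    A.weight t u v w X = (A.sgn : K) * (∏ i, ∏ j, (A.decor i j).coeff t u v w)
      * ∏ i : Fin n, X i ^ A.rowExponent i := by
  simp only [ArrowDecoration.prod_coeff, Finset.prod_mul_distrib, Finset.prod_pow_eq_pow_sum]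
  simp only [weight, count, rowCount]
  ring

theorem weight_succ {K : Type*} [Field K] (t u v w : K) (X : Fin (n + 1) → K)
    (A : ArrowedGTPattern (n + 1)) :
    A.weight t u v w X =
      rowWeight t u v w (X (Fin.last n)) A.bottomRow A.bottomDecor A.truncate.bottomRow
        * A.truncate.weight t u v w fun j => X j.castSucc := by
  have hs : (A.sgn : K) = (∏ j : Fin n,
      (intervalSign (leftEnd (A.bottomRow j.castSucc) (A.bottomDecor j.castSucc))
        (rightEnd (A.bottomRow j.succ) (A.bottomDecor j.succ)) : K)) * (A.truncate.sgn : K) := by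
    rw [sgn, Fin.prod_univ_castSucc, mul_comm, Int.cast_mul, Int.cast_prod]
    rfl
  have he : A.rowExponent (Fin.last n) = ∑ p, A.bottomRow p - ∑ j, A.truncate.bottomRow j
      + ∑ p, (A.bottomDecor p).shift := by
    rw [ArrowDecoration.sum_shift, ← add_sub_assoc]
    rfl
  have hc : ∏ i, ∏ j, (A.decor i j).coeff t u v w
      = (∏ i, ∏ j, (A.truncate.decor i j).coeff t u v w)
        * ∏ p, (A.bottomDecor p).coeff t u v w := Fin.prod_univ_castSucc _
  rw [weight_eq, weight_eq, rowWeight, hs, hc,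
    Fin.prod_univ_castSucc (f := fun i => X i ^ A.rowExponent i), he]
  have hr : ∀ i, A.truncate.rowExponent i = A.rowExponent i.castSucc := fun i => rfl
  simp only [hr]
  ring

/-- A pattern with given bottom row is determined by its bottom decorations and its truncation, and
the bottom row of the truncation ranges over a finite set. -/
theorem finite_bottomRow_eq (k : Fin n → ℤ) :
    {A : ArrowedGTPattern n | A.bottomRow = k}.Finite := by
  induction n with
  | zero =>
    refine Set.Subsingleton.finite fun A _ B _ => ?_
    ext i j
    · exact absurd j.2 (by omega)
    · exact absurd j.2 (by omega)
  | succ n ih =>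
    have hfin : ((Set.univ : Set (Fin (n + 1) → ArrowDecoration)) ×ˢ
        ⋃ d ∈ (Finset.univ : Finset (Fin (n + 1) → ArrowDecoration)), ⋃ l ∈ rowsAbove k d,
          {A : ArrowedGTPattern n | A.bottomRow = l}).Finite :=
      Set.finite_univ.prod (Set.Finite.biUnion (Finset.finite_toSet _) fun d _ =>
        Set.Finite.biUnion (Finset.finite_toSet _) fun l _ => ih l)
    refine Set.Finite.of_injOn (f := fun A => (A.bottomDecor, A.truncate)) ?_ ?_ hfin
    · rintro A rfl
      simp only [Set.mem_prod, Set.mem_univ, true_and, Set.mem_iUnion]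
      exact ⟨A.bottomDecor, Finset.mem_univ _, _, A.bottomRow_truncate_mem, rfl⟩
    · intro A hA B hB h
      obtain ⟨h1, h2⟩ := Prod.mk.inj h
      exact ext_of_truncate h2 (hA.trans hB.symm) h1

theorem agtpGenFun_succ {K : Type*} [Field K] (t u v w : K) (k : Fin (n + 1) → ℤ)
    (X : Fin (n + 1) → K) :
    agtpGenFun t u v w k X = ∑ d : Fin (n + 1) → ArrowDecoration, ∑ l ∈ rowsAbove k d,
      rowWeight t u v w (X (Fin.last n)) k d l
        * agtpGenFun t u v w l fun j => X j.castSucc := by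
  have hG : ∀ {m : ℕ} (k : Fin m → ℤ) (X : Fin m → K), agtpGenFun t u v w k X
      = ∑ A ∈ (finite_bottomRow_eq k).toFinset, A.weight t u v w X := fun k X =>
    finsum_mem_eq_finite_toFinset_sum _ _
  simp only [hG, Finset.mul_sum]
  rw [Finset.sum_sigma', Finset.sum_sigma']
  refine Finset.sum_bij (fun A _ => ⟨⟨A.bottomDecor, A.truncate.bottomRow⟩, A.truncate⟩)
    ?_ ?_ ?_ ?_
  · intro A hA
    obtain rfl : A.bottomRow = k := by simpa using hA
    simpa using A.bottomRow_truncate_mem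
  · intro A hA B hB h
    simp only [Set.Finite.mem_toFinset, Set.mem_ofPred_eq] at hA hB
    simp only [Sigma.mk.injEq, heq_eq_eq] at h
    exact ext_of_truncate h.2 (hA.trans hB.symm) h.1.1
  · rintro ⟨⟨d, l⟩, B⟩ h
    simp only [Finset.mem_sigma, Finset.mem_univ, true_and, Set.Finite.mem_toFinset,
      Set.mem_ofPred_eq] at h
    obtain ⟨h1, rfl⟩ := h
    obtain ⟨A, hA, rfl, rfl⟩ := exists_truncate_eq k d B h1
    exact ⟨A, by simpa using hA, rfl⟩
  · intro A hA
    obtain rfl : A.bottomRow = k := by simpa using hA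
    exact weight_succ t u v w X A

end ArrowedGTPattern

/-! ### The Vandermonde denominator and the final induction -/

theorem prod_Ioi_succ {K : Type*} [Field K] {n : ℕ} (X : Fin (n + 1) → K) :
    ∏ i, ∏ j ∈ Finset.Ioi i, (X j - X i)
      = (∏ i : Fin n, ∏ j ∈ Finset.Ioi i, (X j.castSucc - X i.castSucc))
        * ∏ j : Fin n, (X (Fin.last n) - X j.castSucc) := by
  rw [Fin.prod_univ_castSucc, ← Finset.prod_mul_distrib]
  have h : Finset.Ioi (Fin.last n) = ∅ := by ext; simp [Fin.le_last]
  rw [h, Finset.prod_empty, mul_one]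
  refine Finset.prod_congr rfl fun i _ => ?_
  have h1 : ∀ (r : ℕ) (i : Fin r) (f : Fin r → K),
      ∏ j ∈ Finset.Ioi i, f j = ∏ j, if i < j then f j else 1 := by
    intro r i f
    rw [← Finset.prod_filter]
    exact Finset.prod_congr (by ext; simp) fun _ _ => rfl
  rw [h1, h1, Fin.prod_univ_castSucc]
  simp [Fin.castSucc_lt_last]

theorem agtpGenFun_eq {K : Type*} [Field K] (n : ℕ) (t u v w : K) (k : Fin n → ℤ)
    (X : Fin n → K) (hX0 : ∀ i, X i ≠ 0) (hX : Function.Injective X) :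
    agtpGenFun t u v w k X = antisymmetrizer (numerator t u v w k) X
      / ∏ i : Fin n, ∏ j ∈ Finset.Ioi i, (X j - X i) := by
  induction n with
  | zero =>
    have A : ArrowedGTPattern 0 :=
      ⟨fun i j => absurd j.2 (by omega), fun i j => absurd j.2 (by omega), fun i => i.elim0⟩
    have hA : {B : ArrowedGTPattern 0 | B.bottomRow = k} = {A} := by
      refine Set.eq_singleton_iff_unique_mem.2 ⟨Subsingleton.elim _ _, fun B _ => ?_⟩
      ext i j
      · exact absurd j.2 (by omega)
      · exact absurd j.2 (by omega)
    rw [agtpGenFun, hA, finsum_mem_singleton, ArrowedGTPattern.weight_eq]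
    simp [antisymmetrizer, numerator, pairProd, ArrowedGTPattern.sgn]
  | succ n ih =>
    rw [ArrowedGTPattern.agtpGenFun_succ]
    -- The smaller Vandermonde product does not depend on `l`, so it can be pulled out of the row
    -- sum.
    have h : ∀ l, agtpGenFun t u v w l (fun j : Fin n => X j.castSucc)
        = antisymmetrizer (numerator t u v w l) (fun j : Fin n => X j.castSucc)
          * (∏ i : Fin n, ∏ j ∈ Finset.Ioi i, (X j.castSucc - X i.castSucc))⁻¹ := fun l => by
      rw [ih l _ (fun j => hX0 _) (hX.comp (Fin.castSucc_injective n)), div_eq_mul_inv]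
    simp only [h, ← mul_assoc, ← Finset.sum_mul]
    rw [sum_rowWeight_mul_antisymmetrizer t u v w k X hX0 hX, prod_Ioi_succ, div_eq_mul_inv,
      mul_inv]
    ring

theorem mainTheorem6 {K : Type*} [Field K] (n : ℕ) (t u v w : K) (k : Fin n → ℤ)
    (X : Fin n → K) (hX0 : ∀ i, X i ≠ 0) (hX : Function.Injective X) :
    {A : ArrowedGTPattern n | A.bottomRow = k}.Finite ∧
    agtpGenFun t u v w k X =
      antisymmetrizer
        (fun Y : Fin n → K =>
          (∏ i : Fin n, ∏ j ∈ Finset.Ici i, (v + w * Y i + t * Y j + u * (Y i * Y j)))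
            * ∏ i : Fin n, Y i ^ (k i - 1)) X
      / ∏ i : Fin n, ∏ j ∈ Finset.Ioi i, (X j - X i) :=
  ⟨ArrowedGTPattern.finite_bottomRow_eq k, agtpGenFun_eq n t u v w k X hX0 hX⟩
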